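/- Let $U$ be an abelian partially ordered group, let $S_1$ and $S_2$ be commutative partially ordered monoids that are pocancellative (that is, $sx\le sy$ implies $x\le y$), and let $\varphi_i : U\to S_i$ ($i=1,2$) be monoid homomorphisms that are order embeddings ($\varphi_i(u)\le\varphi_i(v)$ if and only if $u\le v$). Let $S_1\otimes_U S_2$ be the tensor product of $S_1$ and $S_2$ as $U$-posets, that is, the quotient of the poset $S_1\times S_2$ by the poset congruence generated by the pairs $\big((s\varphi_1(u),t),(s,\varphi_2(u)t)\big)$ with $s\in S_1$, $t\in S_2$, $u\in U$; write $s\otimes t$ for the class of $(s,t)$. The order is: $s\otimes t\le s'\otimes t'$ if and only if $(s,t)$ is joined to $(s',t')$ by a finite chain in which each step is an instance of the componentwise order or replaces one member of such a pair by the other. The multiplication is $(s\otimes t)(s'\otimes t')=ss'\otimes tt'$. Then the maps $\lambda_1:S_1\to S_1\otimes_U S_2$, $s\mapsto s\otimes 1$, and $\lambda_2:S_2\to S_1\otimes_U S_2$, $t\mapsto 1\otimes t$, strongly poembed the amalgam $[U;S_1,S_2]$ in $S_1\otimes_U S_2$: both are monoid homomorphisms and order embeddings, $\lambda_1\varphi_1=\lambda_2\varphi_2$,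 and $\lambda_1(S_1)\cap\lambda_2(S_2)=\lambda_1\varphi_1(U)$. Moreover $S_1\otimes_U S_2$ is itself a pocancellative commutative partially ordered monoid. In particular, the amalgam is strongly poembeddable in the class of pocancellative commutative pomonoids. -/

import Mathlib

namespace Pomonoid

universe u v w x

/-- Let `φ₁ : U → S₁`, `φ₂ : U → S₂` be pomonoid morphisms and `θ₁ : S₁ → W`, `θ₂ : S₂ → W` be
pomonoid morphisms into a pomonoid `W`. The maps `θ₁, θ₂` strongly poembed `[U; S₁, S₂; φ₁, φ₂]`
in `W` if both are order embeddings, `θ₁ φ₁ = θ₂ φ₂`, and `θ₁(S₁) ∩ θ₂(S₂) = θ₁ φ₁(U)`. -/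
structure IsStrongPoembedding {U : Type u} {S₁ : Type v} {S₂ : Type w} {W : Type x}
    [Monoid U] [PartialOrder U] [Monoid S₁] [PartialOrder S₁]
    [Monoid S₂] [PartialOrder S₂] [Monoid W] [PartialOrder W]
    (φ₁ : U →*o S₁) (φ₂ : U →*o S₂) (θ₁ : S₁ →*o W) (θ₂ : S₂ →*o W) : Prop where
  le_iff_left : ∀ s s' : S₁, θ₁ s ≤ θ₁ s' ↔ s ≤ s'
  le_iff_right : ∀ t t' : S₂, θ₂ t ≤ θ₂ t' ↔ t ≤ t'
  comm : ∀ a : U, θ₁ (φ₁ a) = θ₂ (φ₂ a)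
  inter_eq : Set.range θ₁ ∩ Set.range θ₂ = Set.range (fun a : U => θ₁ (φ₁ a))

section Tensor

variable {U : Type u} {S₁ : Type v} {S₂ : Type w}
  [CommMonoid U] [PartialOrder U] [CommMonoid S₁] [PartialOrder S₁]
  [CommMonoid S₂] [PartialOrder S₂]

/-- The relation `H = {((s·a, t), (s, a·t))}` on `S₁ × S₂`, where `S₁` is a right `U`-poset by
`s·a = s * φ₁ a` and `S₂` is a left `U`-poset by `a·t = φ₂ a * t`. -/
def TensorRel (φ₁ : U →*o S₁) (φ₂ : U →*o S₂) (p q : S₁ × S₂) : Prop :=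
  ∃ (s : S₁) (a : U) (t : S₂), p = (s * φ₁ a, t) ∧ q = (s, φ₂ a * t)

/-- The preorder on `S₁ × S₂` whose symmetric part is the poset congruence generated by `H`:
`p ≲ q` iff `p` is joined to `q` by a finite chain of steps, each of them an instance of the
product order, of `H` or of `H⁻¹`. -/
def TensorLE (φ₁ : U →*o S₁) (φ₂ : U →*o S₂) : S₁ × S₂ → S₁ × S₂ → Prop :=
  Relation.TransGen fun p q => p ≤ q ∨ TensorRel φ₁ φ₂ p q ∨ TensorRel φ₁ φ₂ q p

variable (φ₁ : U →*o S₁) (φ₂ : U →*o S₂)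

theorem TensorLE.refl (p : S₁ × S₂) : TensorLE φ₁ φ₂ p p :=
  Relation.TransGen.single (Or.inl le_rfl)

variable {φ₁ φ₂}

theorem TensorLE.trans {p q r : S₁ × S₂} (h : TensorLE φ₁ φ₂ p q) (h' : TensorLE φ₁ φ₂ q r) :
    TensorLE φ₁ φ₂ p r :=
  Relation.TransGen.trans h h'

theorem TensorRel.mul_right {p q : S₁ × S₂} (h : TensorRel φ₁ φ₂ p q) (r : S₁ × S₂) :
    TensorRel φ₁ φ₂ (p * r) (q * r) := by
  obtain ⟨s, a, t, rfl, rfl⟩ := h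
  exact ⟨s * r.1, a, t * r.2, Prod.ext (mul_right_comm _ _ _) rfl, Prod.ext rfl (mul_assoc _ _ _)⟩

theorem TensorLE.mul_right [IsOrderedMonoid S₁] [IsOrderedMonoid S₂] {p q : S₁ × S₂}
    (h : TensorLE φ₁ φ₂ p q) (r : S₁ × S₂) : TensorLE φ₁ φ₂ (p * r) (q * r) := by
  have step : ∀ a b : S₁ × S₂, (a ≤ b ∨ TensorRel φ₁ φ₂ a b ∨ TensorRel φ₁ φ₂ b a) →
      TensorLE φ₁ φ₂ (a * r) (b * r) := by
    rintro a b (h | h | h)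
    · exact .single (Or.inl ⟨mul_le_mul_left h.1 r.1, mul_le_mul_left h.2 r.2⟩)
    · exact .single (Or.inr (Or.inl (h.mul_right r)))
    · exact .single (Or.inr (Or.inr (h.mul_right r)))
  induction h with
  | single h => exact step _ _ h
  | tail _ h ih => exact ih.trans (step _ _ h)

theorem TensorLE.mul [IsOrderedMonoid S₁] [IsOrderedMonoid S₂] {p q p' q' : S₁ × S₂}
    (h : TensorLE φ₁ φ₂ p q) (h' : TensorLE φ₁ φ₂ p' q') :
    TensorLE φ₁ φ₂ (p * p') (q * q') := by
  refine (h.mul_right p').trans ?_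
  rw [mul_comm q p', mul_comm q q']
  exact h'.mul_right q

variable (φ₁ φ₂)

/-- The poset congruence on `S₁ × S₂` generated by `H`. -/
def tensorSetoid : Setoid (S₁ × S₂) where
  r p q := TensorLE φ₁ φ₂ p q ∧ TensorLE φ₁ φ₂ q p
  iseqv :=
    { refl := fun p => ⟨TensorLE.refl φ₁ φ₂ p, TensorLE.refl φ₁ φ₂ p⟩
      symm := fun h => ⟨h.2, h.1⟩
      trans := fun h h' => ⟨h.1.trans h'.1, h'.2.trans h.2⟩ }

/-- The tensor product `S₁ ⊗_U S₂` of the `U`-posets `S₁` and `S₂`. -/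
def Tensor : Type (max v w) := Quotient (tensorSetoid φ₁ φ₂)

namespace Tensor

/-- The element `s ⊗ t`. -/
def tmul (s : S₁) (t : S₂) : Tensor φ₁ φ₂ := Quotient.mk (tensorSetoid φ₁ φ₂) (s, t)

/-- `s ⊗ t ≤ s' ⊗ t'` iff `(s, t) ≲ (s', t')`. -/
instance : PartialOrder (Tensor φ₁ φ₂) where
  le := Quotient.lift₂ (s₁ := tensorSetoid φ₁ φ₂) (s₂ := tensorSetoid φ₁ φ₂) (TensorLE φ₁ φ₂)
    fun _ _ _ _ h h' => propext
      ⟨fun k => (h.2.trans k).trans h'.1, fun k => (h.1.trans k).trans h'.2⟩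
  le_refl := by rintro ⟨p⟩; exact TensorLE.refl φ₁ φ₂ p
  le_trans := by
    rintro ⟨p⟩ ⟨q⟩ ⟨r⟩ h h'
    exact TensorLE.trans h h'
  le_antisymm := by
    rintro ⟨p⟩ ⟨q⟩ h h'
    exact Quotient.sound (s := tensorSetoid φ₁ φ₂) ⟨h, h'⟩

variable [IsOrderedMonoid S₁] [IsOrderedMonoid S₂]

/-- `(s ⊗ t) (s' ⊗ t') = s s' ⊗ t t'`, with identity `1 ⊗ 1`. -/
instance : CommMonoid (Tensor φ₁ φ₂) where
  mul := Quotient.map₂ (sa := tensorSetoid φ₁ φ₂) (sb := tensorSetoid φ₁ φ₂)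
    (sc := tensorSetoid φ₁ φ₂) (fun p q => p * q)
    fun _ _ h _ _ h' => ⟨h.1.mul h'.1, h.2.mul h'.2⟩
  one := tmul φ₁ φ₂ 1 1
  mul_assoc := by
    rintro ⟨p⟩ ⟨q⟩ ⟨r⟩
    exact congrArg (Quotient.mk (tensorSetoid φ₁ φ₂)) (mul_assoc p q r)
  one_mul := by
    rintro ⟨p⟩
    exact congrArg (Quotient.mk (tensorSetoid φ₁ φ₂)) (one_mul p)
  mul_one := by
    rintro ⟨p⟩
    exact congrArg (Quotient.mk (tensorSetoid φ₁ φ₂)) (mul_one p)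
  mul_comm := by
    rintro ⟨p⟩ ⟨q⟩
    exact congrArg (Quotient.mk (tensorSetoid φ₁ φ₂)) (mul_comm p q)

/-- The canonical pomonoid morphism `S₁ → S₁ ⊗_U S₂`, `s ↦ s ⊗ 1`. -/
def inl : S₁ →*o Tensor φ₁ φ₂ where
  toFun s := tmul φ₁ φ₂ s 1
  map_one' := rfl
  map_mul' _ _ :=
    congrArg (Quotient.mk (tensorSetoid φ₁ φ₂)) (Prod.ext rfl (mul_one (1 : S₂)).symm)
  monotone' _ _ h := Relation.TransGen.single (Or.inl ⟨h, le_rfl⟩)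

/-- The canonical pomonoid morphism `S₂ → S₁ ⊗_U S₂`, `t ↦ 1 ⊗ t`. -/
def inr : S₂ →*o Tensor φ₁ φ₂ where
  toFun t := tmul φ₁ φ₂ 1 t
  map_one' := rfl
  map_mul' _ _ :=
    congrArg (Quotient.mk (tensorSetoid φ₁ φ₂)) (Prod.ext (mul_one (1 : S₁)).symm rfl)
  monotone' _ _ h := Relation.TransGen.single (Or.inl ⟨le_rfl, h⟩)

end Tensor

end Tensor

end Pomonoid

/-!
Because `U` is a group, the chains defining the order on `S₁ ⊗_U S₂` collapse to a single scalar: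
`s ⊗ t ≤ s' ⊗ t'` iff some `a : U` satisfies `s ≤ s' φ₁(a)` and `φ₂(a) t ≤ t'`
(`Pomonoid.tensorLE_iff`). A step along `H` is witnessed by its own scalar, a step along `H⁻¹` by
the inverse scalar, and composing steps multiplies the witnesses. With this criterion, cancellation
in the tensor product is cancellation in both factors under the same witness, and the embedding
properties follow by comparing the witness with `1` through the order embeddings `φ₁`, `φ₂`.
-/

namespace Pomonoid

section

variable {U : Type*} {S₁ : Type*} {S₂ : Type*}
  [CommGroup U] [PartialOrder U]
  [CommMonoid S₁] [PartialOrder S₁] [CommMonoid S₂] [PartialOrder S₂]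
  {φ₁ : U →*o S₁} {φ₂ : U →*o S₂}

/-- Over a group, every chain of steps reduces to one comparison in each factor, twisted by a
single scalar. -/
theorem tensorLE_iff [IsOrderedMonoid S₁] [IsOrderedMonoid S₂] {p q : S₁ × S₂} :
    TensorLE φ₁ φ₂ p q ↔ ∃ a : U, p.1 ≤ q.1 * φ₁ a ∧ φ₂ a * p.2 ≤ q.2 := by
  constructor
  · intro h
    have step : ∀ p q : S₁ × S₂, (p ≤ q ∨ TensorRel φ₁ φ₂ p q ∨ TensorRel φ₁ φ₂ q p) →
        ∃ a : U, p.1 ≤ q.1 * φ₁ a ∧ φ₂ a * p.2 ≤ q.2 := by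
      rintro p q (h | ⟨s, a, t, rfl, rfl⟩ | ⟨s, a, t, rfl, rfl⟩)
      · exact ⟨1, by simpa using h.1, by simpa using h.2⟩
      · exact ⟨a, le_rfl, le_rfl⟩
      · refine ⟨a⁻¹, ?_, ?_⟩
        · simp [mul_assoc, ← map_mul]
        · simp [← mul_assoc, ← map_mul]
    induction h with
    | single h => exact step _ _ h
    | tail _ h ih =>
      obtain ⟨a, ha₁, ha₂⟩ := ih
      obtain ⟨b, hb₁, hb₂⟩ := step _ _ h
      refine ⟨b * a, ?_, ?_⟩
      · rw [map_mul, ← mul_assoc]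
        exact ha₁.trans (mul_le_mul_left hb₁ _)
      · rw [map_mul, mul_assoc]
        exact (mul_le_mul_right ha₂ _).trans hb₂
  · rintro ⟨a, h₁, h₂⟩
    have h : TensorLE φ₁ φ₂ p (q.1 * φ₁ a, p.2) := .single (.inl ⟨h₁, le_rfl⟩)
    exact (h.tail (.inr (.inl ⟨_, a, _, rfl, rfl⟩))).tail (.inl ⟨le_rfl, h₂⟩)

namespace Tensor

theorem tmul_le_tmul_iff [IsOrderedMonoid S₁] [IsOrderedMonoid S₂] {s s' : S₁} {t t' : S₂} :
    tmul φ₁ φ₂ s t ≤ tmul φ₁ φ₂ s' t' ↔ ∃ a : U, s ≤ s' * φ₁ a ∧ φ₂ a * t ≤ t' :=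
  tensorLE_iff (p := (s, t)) (q := (s', t'))

instance isOrderedCancelMonoid [IsOrderedCancelMonoid S₁] [IsOrderedCancelMonoid S₂] :
    IsOrderedCancelMonoid (Tensor φ₁ φ₂) where
  mul_le_mul_left := by
    rintro ⟨p⟩ ⟨q⟩ h ⟨r⟩
    exact TensorLE.mul_right h r
  le_of_mul_le_mul_left := by
    rintro ⟨r⟩ ⟨p⟩ ⟨q⟩ h
    obtain ⟨a, h₁, h₂⟩ := tensorLE_iff.1 (show TensorLE φ₁ φ₂ (r * p) (r * q) from h)
    refine tensorLE_iff.2 ⟨a, ?_, ?_⟩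
    · rw [Prod.fst_mul, Prod.fst_mul, mul_assoc] at h₁
      exact le_of_mul_le_mul_left' h₁
    · rw [Prod.snd_mul, Prod.snd_mul, mul_left_comm] at h₂
      exact le_of_mul_le_mul_left' h₂

theorem inl_le_inl_iff [IsOrderedMonoid S₁] [IsOrderedMonoid S₂]
    (hφ₂ : ∀ a b : U, φ₂ a ≤ φ₂ b ↔ a ≤ b) {s s' : S₁} :
    inl φ₁ φ₂ s ≤ inl φ₁ φ₂ s' ↔ s ≤ s' := by
  refine ⟨fun h => ?_, fun h => (inl φ₁ φ₂).monotone' h⟩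
  obtain ⟨a, h₁, h₂⟩ := tmul_le_tmul_iff.1 h
  rw [mul_one, ← map_one φ₂, hφ₂] at h₂
  have ha : φ₁ a ≤ 1 := map_one φ₁ ▸ φ₁.monotone' h₂
  exact h₁.trans (mul_le_of_le_one_right' ha)

theorem inr_le_inr_iff [IsOrderedMonoid S₁] [IsOrderedMonoid S₂]
    (hφ₁ : ∀ a b : U, φ₁ a ≤ φ₁ b ↔ a ≤ b) {t t' : S₂} :
    inr φ₁ φ₂ t ≤ inr φ₁ φ₂ t' ↔ t ≤ t' := by
  refine ⟨fun h => ?_, fun h => (inr φ₁ φ₂).monotone' h⟩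
  obtain ⟨a, h₁, h₂⟩ := tmul_le_tmul_iff.1 h
  rw [one_mul, ← map_one φ₁, hφ₁] at h₁
  have ha : 1 ≤ φ₂ a := map_one φ₂ ▸ φ₂.monotone' h₁
  exact (le_mul_of_one_le_left' ha).trans h₂

theorem inl_map_eq_inr_map [IsOrderedMonoid S₁] [IsOrderedMonoid S₂] (a : U) :
    inl φ₁ φ₂ (φ₁ a) = inr φ₁ φ₂ (φ₂ a) :=
  le_antisymm (tmul_le_tmul_iff.2 ⟨a, by simp, by simp⟩)
    (tmul_le_tmul_iff.2 ⟨a⁻¹, by simp [← map_mul], by simp [← map_mul]⟩)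

theorem mem_range_of_inl_eq_inr [IsOrderedCancelMonoid S₁] [IsOrderedMonoid S₂]
    (hφ₁ : ∀ a b : U, φ₁ a ≤ φ₁ b ↔ a ≤ b) (hφ₂ : ∀ a b : U, φ₂ a ≤ φ₂ b ↔ a ≤ b)
    {s : S₁} {t : S₂} (h : inl φ₁ φ₂ s = inr φ₁ φ₂ t) : ∃ a : U, φ₁ a = s := by
  obtain ⟨a, ha₁, ha₂⟩ := tmul_le_tmul_iff.1 h.le
  obtain ⟨b, hb₁, hb₂⟩ := tmul_le_tmul_iff.1 h.ge
  rw [one_mul] at ha₁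
  rw [mul_one] at ha₂
  -- The two witnesses are mutually inverse, one inequality coming from each factor.
  have hle : a * b ≤ 1 := by
    rw [← hφ₂, mul_comm, map_mul, map_one]
    exact (mul_le_mul_right ha₂ _).trans hb₂
  have hge : 1 ≤ a * b := by
    rw [← hφ₁, map_mul, map_one]
    exact hb₁.trans (mul_le_mul_left ha₁ _)
  have hab : φ₁ a * φ₁ b = 1 := by rw [← map_mul, le_antisymm hle hge, map_one]
  exact ⟨a, le_antisymm (le_of_mul_le_mul_right' (hab.le.trans hb₁)) ha₁⟩

end Tensor

end

end Pomonoid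

theorem theorem4
    {U : Type*} {S₁ : Type*} {S₂ : Type*}
    [CommGroup U] [PartialOrder U] [IsOrderedMonoid U]
    [CommMonoid S₁] [PartialOrder S₁] [IsOrderedCancelMonoid S₁]
    [CommMonoid S₂] [PartialOrder S₂] [IsOrderedCancelMonoid S₂]
    (φ₁ : U →*o S₁) (φ₂ : U →*o S₂)
    (hφ₁ : ∀ a b : U, φ₁ a ≤ φ₁ b ↔ a ≤ b) (hφ₂ : ∀ a b : U, φ₂ a ≤ φ₂ b ↔ a ≤ b) :
    Pomonoid.IsStrongPoembedding φ₁ φ₂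
        (Pomonoid.Tensor.inl φ₁ φ₂) (Pomonoid.Tensor.inr φ₁ φ₂) ∧
      IsOrderedCancelMonoid (Pomonoid.Tensor φ₁ φ₂) := by
  refine ⟨⟨fun _ _ => Pomonoid.Tensor.inl_le_inl_iff hφ₂,
    fun _ _ => Pomonoid.Tensor.inr_le_inr_iff hφ₁,
    Pomonoid.Tensor.inl_map_eq_inr_map, Set.Subset.antisymm ?_ ?_⟩, inferInstance⟩
  · rintro _ ⟨⟨s, rfl⟩, t, h⟩
    obtain ⟨a, rfl⟩ := Pomonoid.Tensor.mem_range_of_inl_eq_inr hφ₁ hφ₂ h.symm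
    exact ⟨a, rfl⟩
  · rintro _ ⟨a, rfl⟩
    exact ⟨⟨φ₁ a, rfl⟩, φ₂ a, (Pomonoid.Tensor.inl_map_eq_inr_map a).symm⟩
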